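/- Let $N$ and $k\ge 0$ be integers with $k<N/2$, and let $s$ be $\lfloor k/2\rfloor$ or $\lceil k/2\rceil$ (either choice of rounding $[k/2]$). For $n\ge 1$ let $M_n$ be the $n$-qubit Mermin–Ardehali–Belinskii–Klyshko (MABK) Bell operator, normalized to have local bound $2^{(n-1)/2}$, with the optimal GHZ settings, i.e. each observer measures $\cos\theta\,\sigma_x+\sin\theta\,\sigma_y$ with $\theta=\theta_n$ or $\theta=\theta_n-\pi/2$, where $\theta_n=(n-1)\pi/(4n)$. Explicitly, $M_n=2^{(n-1)/2}B_n$ where $B_1=O$, $B_1'=O'$ are the two observables and $B_{n+1}=\tfrac12 B_n\otimes(O+O')+\tfrac12 B_n'\otimes(O-O')$, $B_{n+1}'=\tfrac12 B_n'\otimes(O'+O)+\tfrac12 B_n\otimes(O'-O)$. Let $|D^i_N\rangle$ denote the $N$-qubit Dicke state with $i$ excitations, i.e. the normalized uniform superposition of the computational basis states with exactly $i$ ones. Then $$M_{N-k}=2^{N-k-1}\left(|D^0_{N-k}\rangle\langle D^{N-k}_{N-k}|+|D^{N-k}_{N-k}\rangle\langle D^0_{N-k}|\right).$$ Define the symmetrized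 Bell operator on $N$ qubits by $$M^{\rm sym}_{N-k}=\sum_{S\subseteq\{1,\dots,N\},\ |S|=N-k}(M_{N-k})|_S\otimes \mathbb 1_k ,$$ where $(M_{N-k})|_S$ acts on the qubits in $S$ and $\mathbb 1_k$ is the identity on the other $k$ qubits. It is Hermitian, its maximum expectation value $Q^{\max}_{N,k}=\max_{\|\psi\|=1}\langle\psi|M^{\rm sym}_{N-k}|\psi\rangle$ over all $N$-qubit states is attained by the normalized $k$-polygamous state $$|\phi^k_N\rangle=\tfrac1{\sqrt2}\left(|D^{s}_N\rangle+|D^{N-k+s}_N\rangle\right),$$ and $$Q^{\max}_{N,k}=2^{N-k-1}\binom Nk\binom ks\binom Ns^{-1/2}\binom N{k-s}^{-1/2}.$$ Moreover $Q^{\max}_{N,k}=\binom Nk\,\mathcal M^{\max}_{N-k}$, where, for every $S$ with $|S|=N-k$, $\mathcal M^{\max}_{N-k}$ is the maximum of $\langle\psi|(M_{N-k})|_S\otimes\mathbb 1_k|\psi\rangle$ over the permutation-invariant pure states $|\psi\rangle=\sum_{i=0}^N c_i|D^i_N\rangle$ of norm one, and this maximum is also attained by $|\phi^k_N\rangle$.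 -/

import Mathlib

/-- Pure-state vectors of `N` qubits, `(ℂ²)^{⊗N}`, with coordinates in the computational basis
`|x⟩`, `x ∈ {0,1}^N`, and the Hilbert-space norm. States are the vectors of norm one. -/
abbrev QubitVec (N : ℕ) : Type := EuclideanSpace ℂ (Fin N → Fin 2)

/-- Operators on `N` qubits, as matrices in the computational basis. -/
abbrev QubitOp (N : ℕ) : Type := Matrix (Fin N → Fin 2) (Fin N → Fin 2) ℂ

namespace QubitOp

/-- The expectation value `⟨ψ|M|ψ⟩` (real for Hermitian `M`). -/
noncomputable def expect {N : ℕ} (M : QubitOp N) (ψ : QubitVec N) : ℝ :=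
  (inner ℂ ψ (Matrix.toEuclideanLin M ψ)).re

/-- `A ⊗ B`, where `A` acts on the first `n` qubits and `B` on one further (last) qubit. -/
def tensorLast {n : ℕ} (A : QubitOp n) (B : Matrix (Fin 2) (Fin 2) ℂ) : QubitOp (n + 1) :=
  fun x y => A (Fin.init x) (Fin.init y) * B (x (Fin.last n)) (y (Fin.last n))

/-- `A|_S ⊗ 𝟙`: the `n`-qubit operator `A` acting on the `n` qubits in `S`
(in increasing order) and the identity on the remaining qubits. -/
def onSubsystem {N n : ℕ} (A : QubitOp n) (S : Finset (Fin N)) (hS : S.card = n) : QubitOp N :=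
  fun x y =>
    if ∀ i, i ∉ S → x i = y i then
      A (fun a => x (S.orderEmbOfFin hS a)) (fun a => y (S.orderEmbOfFin hS a))
    else 0

end QubitOp

/-- The Pauli matrix `σ_x`. -/
def pauliX : Matrix (Fin 2) (Fin 2) ℂ := !![0, 1; 1, 0]

/-- The Pauli matrix `σ_y`. -/
def pauliY : Matrix (Fin 2) (Fin 2) ℂ := !![0, -Complex.I; Complex.I, 0]

/-- The dichotomic qubit observable `cos θ σ_x + sin θ σ_y`. -/
noncomputable def equatorialObs (θ : ℝ) : Matrix (Fin 2) (Fin 2) ℂ :=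
  (Real.cos θ : ℂ) • pauliX + (Real.sin θ : ℂ) • pauliY

/-- The Belinskii-Klyshko recursion for the `n`-party MABK Bell operator `B_n` and its partner
`B'_n` (settings exchanged), every party measuring `O` or `O'`:
`B_{n+1} = ½ B_n ⊗ (O + O') + ½ B'_n ⊗ (O - O')` and
`B'_{n+1} = ½ B'_n ⊗ (O' + O) + ½ B_n ⊗ (O' - O)`, so that `B_1 = O`, `B'_1 = O'`.
In this normalization the local bound is `1`. -/
noncomputable def mabkPair (O O' : Matrix (Fin 2) (Fin 2) ℂ) :
    (n : ℕ) → QubitOp n × QubitOp n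
  | 0 => (1, 1)
  | n + 1 =>
    ((1 / 2 : ℂ) • ((mabkPair O O' n).1.tensorLast (O + O')
        + (mabkPair O O' n).2.tensorLast (O - O')),
     (1 / 2 : ℂ) • ((mabkPair O O' n).2.tensorLast (O' + O)
        + (mabkPair O O' n).1.tensorLast (O' - O)))

/-- The local bound `L_n = 2^{(n-1)/2}` of the `n`-party MABK inequality. -/
noncomputable def mabkLocalBound (n : ℕ) : ℝ := (2 : ℝ) ^ (((n : ℝ) - 1) / 2)

/-- The angle `θ_n = (n-1)π/(4n)` of the optimal GHZ settings. -/
noncomputable def ghzAngle (n : ℕ) : ℝ := ((n : ℝ) - 1) * Real.pi / (4 * (n : ℝ))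

/-- The `n`-qubit MABK Bell operator `M_n` with the optimal GHZ settings, normalized so that
the local bound is `L_n = 2^{(n-1)/2}`. -/
noncomputable def mabkGHZ (n : ℕ) : QubitOp n :=
  (mabkLocalBound n : ℂ) •
    (mabkPair (equatorialObs (ghzAngle n)) (equatorialObs (ghzAngle n - Real.pi / 2)) n).1

/-- The symmetrized operator `M^sym_{N-k} = ∑_{|S| = N-k} (M_{N-k})|_S ⊗ 𝟙_k`. -/
noncomputable def symMABK (N k : ℕ) : QubitOp N :=
  ∑ S : {S : Finset (Fin N) // S.card = N - k}, (mabkGHZ (N - k)).onSubsystem S.1 S.2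

/-- The `N`-qubit Dicke state `|D^i_N⟩` with `i` excitations. -/
noncomputable def dicke (N i : ℕ) : QubitVec N :=
  WithLp.toLp 2 fun x =>
    if (Finset.univ.filter fun a => x a = 1).card = i then
      ((1 / Real.sqrt (N.choose i : ℝ) : ℝ) : ℂ)
    else 0

/-- The operator `|u⟩⟨v|`. -/
noncomputable def ketBra {N : ℕ} (u v : QubitVec N) : QubitOp N :=
  Matrix.vecMulVec u.ofLp (star v.ofLp)

/-- The `k`-polygamous state `(|D^s_N⟩ + |D^{N-k+s}_N⟩)/√2`, where `s` is a rounding of `k/2`. -/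
noncomputable def polygamousState (N k s : ℕ) : QubitVec N :=
  ((1 / Real.sqrt 2 : ℝ) : ℂ) • (dicke N s + dicke N (N - k + s))

/-- The permutation-invariant pure state vector `∑_{i=0}^N c_i |D^i_N⟩`. -/
noncomputable def piVec (N : ℕ) (c : Fin (N + 1) → ℂ) : QubitVec N :=
  ∑ i : Fin (N + 1), c i • dicke N (i : ℕ)

/-- `2^{N-k-1} (k choose s) (N choose s)^{-1/2} (N choose k-s)^{-1/2}`. -/
noncomputable def piOptimum (N k s : ℕ) : ℝ :=
  (2 : ℝ) ^ (N - k - 1) * (k.choose s : ℝ) /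
    (Real.sqrt (N.choose s : ℝ) * Real.sqrt (N.choose (k - s) : ℝ))

/-!
The combinations `B_n ± i B'_n` turn the Belinskii-Klyshko recursion into a plain tensor product.
With the GHZ settings each one-qubit factor is a multiple of `|1⟩⟨0|` or of `|0⟩⟨1|`, so `M_n` is
`2^(n-1) (|0⋯0⟩⟨1⋯1| + |1⋯1⟩⟨0⋯0|)`; the angle `θ_n` makes the phase trivial
(`mabkPair_apply`, `ghzAngle_amplitude`, `mabkGHZ_apply`).

Write `n = N - k` and identify basis states with subsets of the `N` qubits. Then `M_n` on `S`
exchanges `T` and `T ∪ S` for every `T` disjoint from `S`, and the symmetrized operator is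
`2^(n-1)` times the adjacency matrix of the graph joining `T` to `T ∪ S` for all disjoint `T`, `S`
with `|S| = n` (`expect_mabkGHZ_onSubsystem`, `expect_symMABK`). Since `k < n`, this graph is a
disjoint union of bipartite graphs between the levels `i` and `n + i` for `i ≤ k`, besides isolated
vertices. Each is biregular, with degrees `(N-i choose n)` and `(n+i choose n)`, so by a weighted
inequality between arithmetic and geometric means its norm is at most the square root of the product
of the degrees (`sum_edges_le`). This product is symmetric under `i ↦ k - i` and increases up to the
centre, hence is maximal at `i = s` (`choose_mul_choose_le_central`), and there the square root is
`(N choose k) (k choose s) (N choose s)^(-1/2) (N choose k-s)^(-1/2)`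
(`choose_mul_choose_eq_polygamous`).

On a permutation-invariant state all subsystems `S` contribute equally (`expect_symMABK_of_card`).
Thus the bound for a single `S` follows from the bound for the symmetrized operator, and the
polygamous state, whose value on one `S` is computed directly
(`expect_onSubsystem_polygamousState`), attains both.
-/

/-! ### The MABK operator in the computational basis -/

/-- The combinations `B_n ± i B'_n` are product operators: they turn the Belinskii-Klyshko
recursion into tensoring with the one-qubit operators `(1 ∓ i)/2 • (O ± i O')`. -/
lemma mabkPair_apply (O O' : Matrix (Fin 2) (Fin 2) ℂ) (n : ℕ) (x y : Fin n → Fin 2) :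
    (mabkPair O O' n).1 x y =
      1 / 2 * ((1 + Complex.I) *
          ∏ a, ((1 - Complex.I) / 2 * (O (x a) (y a) + Complex.I * O' (x a) (y a)))
        + (1 - Complex.I) *
          ∏ a, ((1 + Complex.I) / 2 * (O (x a) (y a) - Complex.I * O' (x a) (y a)))) ∧
    (mabkPair O O' n).2 x y =
      -Complex.I / 2 * ((1 + Complex.I) *
          ∏ a, ((1 - Complex.I) / 2 * (O (x a) (y a) + Complex.I * O' (x a) (y a)))
        - (1 - Complex.I) *
          ∏ a, ((1 + Complex.I) / 2 * (O (x a) (y a) - Complex.I * O' (x a) (y a)))) := by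
  have hI : Complex.I * Complex.I = -1 := Complex.I_mul_I
  induction n with
  | zero =>
    have hxy : x = y := Subsingleton.elim _ _
    subst hxy
    simp only [mabkPair, Matrix.one_apply_eq, Finset.univ_eq_empty, Finset.prod_empty]
    constructor
    · ring
    · linear_combination hI
  | succ n ih =>
    obtain ⟨h1, h2⟩ := ih (Fin.init x) (Fin.init y)
    simp only [mabkPair, Matrix.smul_apply, Matrix.add_apply, QubitOp.tensorLast, Matrix.sub_apply,
      h1, h2, Fin.prod_univ_castSucc, smul_eq_mul, Fin.init]
    generalize ∏ a : Fin n, ((1 - Complex.I) / 2 *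
      (O (x a.castSucc) (y a.castSucc) + Complex.I * O' (x a.castSucc) (y a.castSucc))) = P
    generalize ∏ a : Fin n, ((1 + Complex.I) / 2 *
      (O (x a.castSucc) (y a.castSucc) - Complex.I * O' (x a.castSucc) (y a.castSucc))) = R
    generalize O (x (Fin.last n)) (y (Fin.last n)) = o
    generalize O' (x (Fin.last n)) (y (Fin.last n)) = o'
    generalize Complex.I = i at *
    have hI2 : i ^ 2 = -1 := by rw [sq, hI]
    have hI3 : i ^ 3 = -i := by rw [pow_succ, hI2]; ring
    have hI4 : i ^ 4 = 1 := by rw [show 4 = 2 * 2 from rfl, pow_mul, hI2]; ring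
    constructor
    · ring_nf
      simp only [hI2, hI3]
      ring
    · ring_nf
      simp only [hI2, hI3, hI4]
      ring

lemma equatorialObs_eq (θ : ℝ) :
    equatorialObs θ =
      !![0, Complex.exp (-(θ * Complex.I)); Complex.exp (θ * Complex.I), 0] := by
  rw [← neg_mul, Complex.exp_mul_I, Complex.exp_mul_I]
  ext i j
  fin_cases i <;> fin_cases j <;>
    simp [equatorialObs, pauliX, pauliY]

lemma equatorialObs_sub_pi_div_two (θ : ℝ) :
    equatorialObs (θ - Real.pi / 2) =
      !![0, Complex.I * Complex.exp (-(θ * Complex.I));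
        -Complex.I * Complex.exp (θ * Complex.I), 0] := by
  have h : Complex.exp (Real.pi / 2 * Complex.I) = Complex.I := Complex.exp_pi_div_two_mul_I
  rw [equatorialObs_eq]
  push_cast
  rw [show -((θ - Real.pi / 2 : ℂ) * Complex.I) =
      Real.pi / 2 * Complex.I + -(θ * Complex.I) by ring,
    show (θ - Real.pi / 2 : ℂ) * Complex.I = -(Real.pi / 2 * Complex.I) + θ * Complex.I by ring,
    Complex.exp_add, Complex.exp_add, Complex.exp_neg (Real.pi / 2 * Complex.I), h, Complex.inv_I]

lemma prod_ite_one_zero {n : ℕ} (c : ℂ) (p : Fin n → Prop) [DecidablePred p] :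
    ∏ a, (if p a then c else 0) = if ∀ a, p a then c ^ n else 0 := by
  split_ifs with h
  · simp [h]
  · push Not at h
    obtain ⟨a, ha⟩ := h
    exact Finset.prod_eq_zero (Finset.mem_univ a) (by simp [ha])

/-- The phase `θ_n` is chosen such that the amplitude `(1 + i) ((1 - i) e^{iθ_n})^n` of
`|1⋯1⟩⟨0⋯0|` is real. -/
lemma ghzAngle_amplitude {n : ℕ} (hn : n ≠ 0) :
    (mabkLocalBound n : ℂ) * ((1 + Complex.I) *
      ((1 - Complex.I) * Complex.exp (ghzAngle n * Complex.I)) ^ n) = 2 ^ n := by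
  have hn' : (n : ℂ) ≠ 0 := by exact_mod_cast hn
  have hs : (Real.sqrt 2 : ℂ) * Real.sqrt 2 = 2 := by
    exact_mod_cast Real.mul_self_sqrt (by norm_num : (0 : ℝ) ≤ 2)
  have e1 : (1 + Complex.I) = Real.sqrt 2 * Complex.exp ((Real.pi / 4 : ℝ) * Complex.I) := by
    rw [Complex.exp_mul_I, ← Complex.ofReal_cos, ← Complex.ofReal_sin, Real.cos_pi_div_four,
      Real.sin_pi_div_four]
    push_cast
    linear_combination (-1 / 2 - Complex.I / 2) * hs
  have e2 : (1 - Complex.I) = Real.sqrt 2 * Complex.exp (-(Real.pi / 4 : ℝ) * Complex.I) := by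
    rw [← Complex.ofReal_neg, Complex.exp_mul_I, ← Complex.ofReal_cos, ← Complex.ofReal_sin,
      Real.cos_neg, Real.sin_neg, Real.cos_pi_div_four, Real.sin_pi_div_four]
    push_cast
    linear_combination (-1 / 2 + Complex.I / 2) * hs
  have e3 : (1 + Complex.I) * ((1 - Complex.I) * Complex.exp (ghzAngle n * Complex.I)) ^ n
      = (Real.sqrt 2 : ℂ) ^ (n + 1) := by
    rw [e1, e2, mul_assoc (Real.sqrt 2 : ℂ) (Complex.exp (-_ * _)),
      ← Complex.exp_add, mul_pow, ← Complex.exp_nat_mul,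
      mul_mul_mul_comm, ← Complex.exp_add]
    have : ((Real.pi / 4 : ℝ) : ℂ) * Complex.I +
        n * (-((Real.pi / 4 : ℝ) : ℂ) * Complex.I + ghzAngle n * Complex.I) = 0 := by
      simp only [ghzAngle]
      push_cast
      field_simp
      ring
    rw [this, Complex.exp_zero]
    ring
  have e4 : mabkLocalBound n * Real.sqrt 2 ^ (n + 1) = 2 ^ n := by
    rw [mabkLocalBound, Real.sqrt_eq_rpow, ← Real.rpow_natCast, ← Real.rpow_mul (by norm_num),
      ← Real.rpow_add (by norm_num), ← Real.rpow_natCast]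
    congr 1
    push_cast
    ring
  rw [e3]
  exact_mod_cast e4

lemma mabkGHZ_apply {n : ℕ} (hn : n ≠ 0) (x y : Fin n → Fin 2) :
    mabkGHZ n x y = 2 ^ (n - 1) *
      ((if (∀ a, x a = 0) ∧ ∀ a, y a = 1 then 1 else 0)
        + if (∀ a, x a = 1) ∧ ∀ a, y a = 0 then 1 else 0) := by
  have amp := ghzAngle_amplitude hn
  -- the amplitude of `|0⋯0⟩⟨1⋯1|` is the complex conjugate
  have amp' := congrArg (starRingEnd ℂ) amp
  simp only [map_mul, map_pow, map_add, map_sub, map_one, Complex.conj_I, Complex.conj_ofReal,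
    ← Complex.exp_conj, map_ofNat] at amp'
  rw [mul_neg, sub_neg_eq_add, ← sub_eq_add_neg] at amp'
  have f1 : ∀ i j : Fin 2, (1 - Complex.I) / 2 * (equatorialObs (ghzAngle n) i j
      + Complex.I * equatorialObs (ghzAngle n - Real.pi / 2) i j)
      = if i = 1 ∧ j = 0 then (1 - Complex.I) * Complex.exp (ghzAngle n * Complex.I) else 0 := by
    intro i j
    rw [equatorialObs_sub_pi_div_two, equatorialObs_eq]
    fin_cases i <;> fin_cases j <;> simp <;> ring_nf <;> simp <;> ring
  have f2 : ∀ i j : Fin 2, (1 + Complex.I) / 2 * (equatorialObs (ghzAngle n) i j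
      - Complex.I * equatorialObs (ghzAngle n - Real.pi / 2) i j)
      = if i = 0 ∧ j = 1 then (1 + Complex.I) * Complex.exp (-(ghzAngle n * Complex.I)) else 0 := by
    intro i j
    rw [equatorialObs_sub_pi_div_two, equatorialObs_eq]
    fin_cases i <;> fin_cases j <;> simp <;> ring_nf <;> simp <;> ring
  simp only [mabkGHZ, Matrix.smul_apply, (mabkPair_apply _ _ n x y).1, f1, f2, prod_ite_one_zero,
    forall_and, smul_eq_mul]
  have h2 : (2 : ℂ) ^ n = 2 * 2 ^ (n - 1) := by
    rw [← pow_succ', Nat.sub_add_cancel (Nat.pos_of_ne_zero hn)]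
  rw [h2] at amp amp'
  split_ifs
  · linear_combination 1 / 2 * amp + 1 / 2 * amp'
  · linear_combination 1 / 2 * amp
  · linear_combination 1 / 2 * amp'
  · ring

lemma dicke_zero_apply (n : ℕ) (x : Fin n → Fin 2) :
    dicke n 0 x = if ∀ a, x a = 0 then 1 else 0 := by
  have : ∀ i : Fin 2, i ≠ 1 ↔ i = 0 := by decide
  simp [dicke, Finset.filter_eq_empty_iff, this]

lemma dicke_self_apply (n : ℕ) (x : Fin n → Fin 2) :
    dicke n n x = if ∀ a, x a = 1 then 1 else 0 := by
  have := Finset.card_filter_eq_iff (s := Finset.univ) (p := fun a => x a = 1)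
  simp only [Finset.card_univ, Fintype.card_fin] at this
  simp [dicke, this]

lemma mabkGHZ_eq_ketBra {n : ℕ} (hn : n ≠ 0) :
    mabkGHZ n = (2 : ℂ) ^ (n - 1) •
      (ketBra (dicke n 0) (dicke n n) + ketBra (dicke n n) (dicke n 0)) := by
  ext x y
  rw [mabkGHZ_apply hn]
  simp only [ketBra, Matrix.smul_apply, Matrix.add_apply, Matrix.vecMulVec_apply, Pi.star_apply,
    dicke_zero_apply, dicke_self_apply, smul_eq_mul, ite_and]
  congr 1
  split_ifs <;> simp

lemma mabkGHZ_isHermitian {n : ℕ} (hn : n ≠ 0) : (mabkGHZ n).IsHermitian := by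
  ext x y
  rw [Matrix.conjTranspose_apply, mabkGHZ_apply hn, mabkGHZ_apply hn]
  simp only [star_mul', star_add, star_pow, apply_ite star, star_one, star_zero, star_ofNat]
  rw [add_comm]
  simp only [and_comm]

lemma QubitOp.onSubsystem_isHermitian {N n : ℕ} {A : QubitOp n} (hA : A.IsHermitian)
    (S : Finset (Fin N)) (hS : S.card = n) : (A.onSubsystem S hS).IsHermitian := by
  ext x y
  rw [Matrix.conjTranspose_apply]
  simp only [QubitOp.onSubsystem, apply_ite star, star_zero, hA.apply, eq_comm]

lemma symMABK_isHermitian {N k : ℕ} (hk : N - k ≠ 0) : (symMABK N k).IsHermitian :=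
  isSelfAdjoint_sum _ fun S _ =>
    QubitOp.onSubsystem_isHermitian (mabkGHZ_isHermitian hk) S.1 S.2

/-! ### Expectation values as sums over subsets -/

/-- Computational basis states as subsets: `T` corresponds to the bit string with ones exactly at
the positions in `T`. -/
def bitString (N : ℕ) : Finset (Fin N) ≃ (Fin N → Fin 2) where
  toFun T := fun a => if a ∈ T then 1 else 0
  invFun x := Finset.univ.filter fun a => x a = 1
  left_inv T := by ext a; simp
  right_inv x := by
    ext a
    have : ∀ i : Fin 2, i ≠ 1 → 0 = i := by decide
    by_cases h : x a = 1
    · simp [h]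
    · simp [h, this _ h]

lemma bitString_eq_one_iff {N : ℕ} (T : Finset (Fin N)) (a : Fin N) :
    bitString N T a = 1 ↔ a ∈ T := by
  simp [bitString]

lemma bitString_eq_zero_iff {N : ℕ} (T : Finset (Fin N)) (a : Fin N) :
    bitString N T a = 0 ↔ a ∉ T := by
  simp [bitString]

lemma norm_sq_eq_sum_bitString {N : ℕ} (ψ : QubitVec N) :
    ‖ψ‖ ^ 2 = ∑ T, ‖ψ (bitString N T)‖ ^ 2 := by
  rw [EuclideanSpace.norm_sq_eq, ← (bitString N).sum_comp]

lemma QubitOp.expect_eq_sum {N : ℕ} (M : QubitOp N) (ψ : QubitVec N) :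
    M.expect ψ = (∑ T, ∑ U, starRingEnd ℂ (ψ (bitString N T)) * M (bitString N T) (bitString N U)
      * ψ (bitString N U)).re := by
  rw [QubitOp.expect, PiLp.inner_apply, ← (bitString N).sum_comp]
  congr 1
  refine Finset.sum_congr rfl fun T _ => ?_
  have hM (x) : Matrix.toEuclideanLin M ψ x = ∑ U, M x (bitString N U) * ψ (bitString N U) :=
    ((bitString N).sum_comp fun y => M x y * ψ y).symm
  rw [RCLike.inner_apply, hM, Finset.sum_mul]
  exact Finset.sum_congr rfl fun U _ => by ring

/-- `M_n` on the qubits in `S` flips all of them together, from all zeros to all ones or back. -/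
lemma mabkGHZ_onSubsystem_apply {N n : ℕ} (hn : n ≠ 0) (S : Finset (Fin N)) (hS : S.card = n)
    (T U : Finset (Fin N)) :
    (mabkGHZ n).onSubsystem S hS (bitString N T) (bitString N U) = 2 ^ (n - 1) *
      ((if Disjoint T S ∧ U = T ∪ S then 1 else 0)
        + if Disjoint U S ∧ T = U ∪ S then 1 else 0) := by
  have range (p : Fin N → Prop) : (∀ a, p (S.orderEmbOfFin hS a)) ↔ ∀ i ∈ S, p i := by
    rw [← Set.forall_mem_range (f := S.orderEmbOfFin hS), Finset.range_orderEmbOfFin]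
    simp
  have agree : (∀ i, i ∉ S → bitString N T i = bitString N U i) ↔
      ∀ i, i ∉ S → (i ∈ T ↔ i ∈ U) := by
    refine forall₂_congr fun i _ => ?_
    by_cases h1 : i ∈ T <;> by_cases h2 : i ∈ U <;> simp [bitString, h1, h2]
  have key (T U : Finset (Fin N)) :
      (∀ i, i ∉ S → (i ∈ T ↔ i ∈ U)) ∧ (∀ i ∈ S, i ∉ T) ∧ (∀ i ∈ S, i ∈ U)
        ↔ Disjoint T S ∧ U = T ∪ S := by
    rw [Finset.disjoint_right, Finset.ext_iff]
    simp only [Finset.mem_union]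
    grind
  have key' : (∀ i, i ∉ S → (i ∈ T ↔ i ∈ U)) ∧ (∀ i ∈ S, i ∈ T) ∧ (∀ i ∈ S, i ∉ U)
      ↔ Disjoint U S ∧ T = U ∪ S := by
    rw [← key U T]
    grind
  simp only [← key T U, ← key', QubitOp.onSubsystem, mabkGHZ_apply hn, agree,
    bitString_eq_one_iff, bitString_eq_zero_iff, range (· ∉ T), range (· ∉ U),
    range (· ∈ T), range (· ∈ U)]
  by_cases h : ∀ i, i ∉ S → (i ∈ T ↔ i ∈ U)
  · have drop (q : Prop) : (∀ i, i ∉ S → (i ∈ T ↔ i ∈ U)) ∧ q ↔ q := and_iff_right h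
    simp only [drop, if_pos h]
  · simp [h]

/-- The flips `T ∪ S → T` are the adjoints of the flips `T → T ∪ S`, so they only double the real
part; hence the factor `2^n` in place of `2^(n-1)`. -/
lemma expect_mabkGHZ_onSubsystem {N n : ℕ} (hn : n ≠ 0) (S : Finset (Fin N)) (hS : S.card = n)
    (ψ : QubitVec N) :
    ((mabkGHZ n).onSubsystem S hS).expect ψ = 2 ^ n * ∑ T ∈ Sᶜ.powerset,
      (starRingEnd ℂ (ψ (bitString N T)) * ψ (bitString N (T ∪ S))).re := by
  have hmem (T : Finset (Fin N)) : T ∈ Sᶜ.powerset ↔ Disjoint T S := by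
    rw [Finset.mem_powerset, Finset.subset_compl_iff_disjoint_right]
  have hsum (F : Finset (Fin N) → Finset (Fin N) → ℂ) :
      ∑ T, ∑ U, F T U * (if Disjoint T S ∧ U = T ∪ S then 1 else 0)
        = ∑ T ∈ Sᶜ.powerset, F T (T ∪ S) := by
    rw [← Finset.sum_subset (Finset.subset_univ Sᶜ.powerset)]
    · refine Finset.sum_congr rfl fun T hT => ?_
      simp [(hmem T).1 hT]
    · intro T _ hT
      simp [mt (hmem T).2 hT]
  have h2 : (2 : ℝ) ^ n = 2 ^ (n - 1) * 2 := by
    rw [← pow_succ, Nat.sub_add_cancel (Nat.pos_of_ne_zero hn)]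
  set g : Finset (Fin N) → ℂ := fun T => ψ (bitString N T) with hg
  have hconj : ∑ T ∈ Sᶜ.powerset, g T * starRingEnd ℂ (g (T ∪ S))
      = starRingEnd ℂ (∑ T ∈ Sᶜ.powerset, starRingEnd ℂ (g T) * g (T ∪ S)) := by
    simp [map_sum]
  have hsplit : ∑ T, ∑ U, starRingEnd ℂ (g T)
        * (mabkGHZ n).onSubsystem S hS (bitString N T) (bitString N U) * g U
      = ((2 ^ (n - 1) : ℝ) : ℂ) * (∑ T ∈ Sᶜ.powerset, starRingEnd ℂ (g T) * g (T ∪ S)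
        + ∑ T ∈ Sᶜ.powerset, g T * starRingEnd ℂ (g (T ∪ S))) := by
    rw [← hsum fun T U => starRingEnd ℂ (g T) * g U, ← hsum fun T U => g T * starRingEnd ℂ (g U),
      Finset.sum_comm (f := fun T U => g T * starRingEnd ℂ (g U) * _), ← Finset.sum_add_distrib,
      Finset.mul_sum]
    refine Finset.sum_congr rfl fun T _ => ?_
    rw [← Finset.sum_add_distrib, Finset.mul_sum]
    refine Finset.sum_congr rfl fun U _ => ?_
    rw [mabkGHZ_onSubsystem_apply hn]
    push_cast
    ring
  rw [QubitOp.expect_eq_sum, hsplit, hconj, Complex.re_ofReal_mul, Complex.add_re, Complex.conj_re,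
    ← Complex.re_sum, h2]
  ring

lemma QubitOp.expect_sum {N : ℕ} {ι : Type*} (s : Finset ι) (M : ι → QubitOp N) (ψ : QubitVec N) :
    QubitOp.expect (∑ i ∈ s, M i) ψ = ∑ i ∈ s, (M i).expect ψ := by
  simp only [QubitOp.expect, map_sum, LinearMap.sum_apply, inner_sum, Complex.re_sum]

lemma expect_symMABK {N k : ℕ} (hk : N - k ≠ 0) (ψ : QubitVec N) :
    (symMABK N k).expect ψ = 2 ^ (N - k) *
      ∑ S ∈ Finset.powersetCard (N - k) Finset.univ, ∑ T ∈ Sᶜ.powerset,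
        (starRingEnd ℂ (ψ (bitString N T)) * ψ (bitString N (T ∪ S))).re := by
  rw [symMABK, QubitOp.expect_sum, Finset.mul_sum,
    Finset.sum_subtype (p := fun S : Finset (Fin N) => S.card = N - k) _ (by simp)]
  exact Finset.sum_congr rfl fun S _ => expect_mabkGHZ_onSubsystem hk S.1 S.2 ψ

/-! ### Unimodality of the vertex degrees -/

lemma choose_mul_choose_le_succ (n : ℕ) {i m : ℕ} (h : i ≤ m) :
    (n + m + 1).choose n * (n + i).choose n ≤ (n + m).choose n * (n + i + 1).choose n := by
  have h1 := Nat.choose_mul_succ_eq (n + m) n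
  have h2 := Nat.choose_mul_succ_eq (n + i) n
  rw [show n + m + 1 - n = m + 1 by omega] at h1
  rw [show n + i + 1 - n = i + 1 by omega] at h2
  have h3 : (n + m + 1) * (i + 1) ≤ (m + 1) * (n + i + 1) := by nlinarith
  refine Nat.le_of_mul_le_mul_right (c := (m + 1) * (i + 1)) ?_ (by positivity)
  calc (n + m + 1).choose n * (n + i).choose n * ((m + 1) * (i + 1))
      = (n + m + 1).choose n * (m + 1) * ((n + i).choose n * (i + 1)) := by ring
    _ = (n + m).choose n * (n + i).choose n * ((n + m + 1) * (i + 1)) := by rw [← h1]; ring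
    _ ≤ (n + m).choose n * (n + i).choose n * ((m + 1) * (n + i + 1)) := by gcongr
    _ = (n + m).choose n * (m + 1) * ((n + i).choose n * (n + i + 1)) := by ring
    _ = (n + m).choose n * (n + i + 1).choose n * ((m + 1) * (i + 1)) := by rw [h2]; ring

/-- The product of the two vertex degrees between levels `i` and `n + i` of the Boolean lattice
is largest for the central `i`. -/
lemma choose_mul_choose_le_central {n k s i : ℕ} (hs : s = k / 2 ∨ s = (k + 1) / 2) (hi : i ≤ k) :
    (n + k - i).choose n * (n + i).choose n ≤ (n + k - s).choose n * (n + s).choose n := by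
  have mono : ∀ i j, i ≤ j → j ≤ (k + 1) / 2 →
      (n + k - i).choose n * (n + i).choose n ≤ (n + k - j).choose n * (n + j).choose n := by
    intro i j hij
    induction j, hij using Nat.le_induction with
    | base => exact fun _ => le_rfl
    | succ j _ ih =>
      intro hj
      have := choose_mul_choose_le_succ n (show j ≤ k - j - 1 by omega)
      rw [show n + (k - j - 1) + 1 = n + k - j by omega,
        show n + (k - j - 1) = n + k - (j + 1) by omega] at this
      exact (ih (by omega)).trans this
  rcases le_or_gt i s with his | his
  · exact mono i s his (by omega)
  · have h1 : n + k - i = n + (k - i) := by omega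
    have h2 : n + k - (k - i) = n + i := by omega
    -- reflection `i ↦ k - i` exchanges the two factors
    have symm : (n + k - i).choose n * (n + i).choose n
        = (n + k - (k - i)).choose n * (n + (k - i)).choose n := by rw [h1, h2, mul_comm]
    rw [symm]
    exact mono (k - i) s (by omega) (by omega)

/-- The double count `(N choose k) (k choose s) = (N choose s) (N-s choose k-s)` times its
counterpart with `k - s` for `s`. -/
lemma choose_mul_choose_eq_polygamous {N k s : ℕ} (hk : k ≤ N) (hs : s ≤ k) :
    (N.choose k : ℝ) * (k.choose s / (Real.sqrt (N.choose s) * Real.sqrt (N.choose (k - s))))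
      = Real.sqrt ((N - s).choose (N - k) * (N - k + s).choose (N - k)) := by
  have e1 := Nat.choose_mul (n := N) hs
  have e2 := Nat.choose_mul (n := N) (Nat.sub_le k s)
  rw [Nat.choose_symm hs, Nat.sub_sub_self hs, show N - (k - s) = N - k + s by omega,
    ← Nat.choose_symm_add] at e2
  rw [← Nat.choose_symm (show k - s ≤ N - s by omega), show N - s - (k - s) = N - k by omega] at e1
  have p1 : (0 : ℝ) < N.choose s := by exact_mod_cast Nat.choose_pos (hs.trans hk)
  have p2 : (0 : ℝ) < N.choose (k - s) := by exact_mod_cast Nat.choose_pos (by omega)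
  rw [← mul_div_assoc, ← Real.sqrt_mul p1.le, eq_comm,
    Real.sqrt_eq_iff_mul_self_eq (by positivity) (by positivity),
    div_mul_div_comm, Real.mul_self_sqrt (by positivity), eq_div_iff (by positivity)]
  have e1' : (N.choose k : ℝ) * k.choose s = N.choose s * (N - s).choose (N - k) := by
    exact_mod_cast e1
  have e2' : (N.choose k : ℝ) * k.choose s = N.choose (k - s) * (N - k + s).choose (N - k) := by
    exact_mod_cast e2
  linear_combination -(N.choose k * k.choose s : ℝ) * e1'
    - (N.choose s * (N - s).choose (N - k) : ℝ) * e2'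

/-! ### The bound over all states -/

lemma two_mul_re_conj_mul_le (a b : ℂ) {t : ℝ} (ht : 0 < t) :
    2 * (starRingEnd ℂ a * b).re ≤ t * ‖a‖ ^ 2 + t⁻¹ * ‖b‖ ^ 2 := by
  have h1 : (starRingEnd ℂ a * b).re ≤ ‖a‖ * ‖b‖ := by
    simpa using Complex.re_le_norm (starRingEnd ℂ a * b)
  have h2 := two_mul_le_add_sq (Real.sqrt t * ‖a‖) (Real.sqrt t⁻¹ * ‖b‖)
  rw [mul_pow, mul_pow, Real.sq_sqrt ht.le, Real.sq_sqrt (inv_pos.2 ht).le] at h2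
  have h3 : Real.sqrt t * Real.sqrt t⁻¹ = 1 := by
    rw [← Real.sqrt_mul ht.le, mul_inv_cancel₀ ht.ne', Real.sqrt_one]
  linear_combination 2 * h1 + h2 - 2 * ‖a‖ * ‖b‖ * h3

/-- Counting the edges `T — T ∪ S` with `|S| = n` by their lower vertex `T`. -/
lemma sum_lower_vertex {N : ℕ} (n : ℕ) (F : Finset (Fin N) → ℝ) :
    ∑ S ∈ Finset.powersetCard n Finset.univ, ∑ T ∈ Sᶜ.powerset, F T
      = ∑ T, ((N - T.card).choose n : ℝ) * F T := by
  rw [Finset.sum_comm' (t' := Finset.univ) (s' := fun T => Finset.powersetCard n Tᶜ)]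
  · refine Finset.sum_congr rfl fun T _ => ?_
    simp [Finset.card_compl]
  · intro S T
    simp only [Finset.mem_powersetCard, Finset.mem_powerset, Finset.subset_univ, Finset.mem_univ,
      Finset.subset_compl_iff_disjoint_right, disjoint_comm, true_and, and_true]
    exact and_comm

/-- Counting the edges `T — T ∪ S` with `|S| = n` by their upper vertex `T ∪ S`. -/
lemma sum_upper_vertex {N : ℕ} (n : ℕ) (F : Finset (Fin N) → ℝ) :
    ∑ S ∈ Finset.powersetCard n Finset.univ, ∑ T ∈ Sᶜ.powerset, F (T ∪ S)
      = ∑ U : Finset (Fin N), (U.card.choose n : ℝ) * F U := by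
  have inner (S : Finset (Fin N)) :
      ∑ T ∈ Sᶜ.powerset, F (T ∪ S) = ∑ U ∈ Finset.univ.filter (S ⊆ ·), F U := by
    refine Finset.sum_bij' (fun T _ => T ∪ S) (fun U _ => U \ S) ?_ ?_ ?_ ?_ ?_
    · simp
    · intro U _
      simp [Finset.subset_compl_iff_disjoint_right, Finset.sdiff_disjoint]
    · intro T hT
      rw [Finset.mem_powerset, Finset.subset_compl_iff_disjoint_right] at hT
      simp [Finset.union_sdiff_right, hT]
    · intro U hU
      simpa using hU
    · simp
  simp only [inner]
  rw [Finset.sum_comm' (t' := Finset.univ) (s' := fun U => Finset.powersetCard n U)]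
  · simp
  · intro S U
    simp [Finset.mem_powersetCard, and_comm]

/-- The edges join level `i` to level `n + i`, and these levels are disjoint for distinct `i ≤ k`
because `k < n`. Between two such levels the graph is biregular, so the square root of the product
of its two degrees bounds the quadratic form. -/
lemma sum_edges_le {n k s : ℕ} (hkn : k < n) (hs : s = k / 2 ∨ s = (k + 1) / 2)
    (g : Finset (Fin (n + k)) → ℂ) :
    2 * ∑ S ∈ Finset.powersetCard n Finset.univ, ∑ T ∈ Sᶜ.powerset,
        (starRingEnd ℂ (g T) * g (T ∪ S)).re
      ≤ Real.sqrt ((n + k - s).choose n * (n + s).choose n) * ∑ T, ‖g T‖ ^ 2 := by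
  have pos : ∀ i ≤ k, (0 : ℝ) < (n + k - i).choose n ∧ (0 : ℝ) < (n + i).choose n := fun i hi =>
    ⟨by exact_mod_cast Nat.choose_pos (by omega), by exact_mod_cast Nat.choose_pos (by omega)⟩
  -- the weight that balances the two degrees
  set t : ℕ → ℝ := fun i => Real.sqrt ((n + i).choose n) / Real.sqrt ((n + k - i).choose n) with ht
  have tpos : ∀ i ≤ k, 0 < t i := fun i hi =>
    div_pos (Real.sqrt_pos.2 (pos i hi).2) (Real.sqrt_pos.2 (pos i hi).1)
  have deg : ∀ i ≤ k, Real.sqrt ((n + k - i).choose n * (n + i).choose n)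
      ≤ Real.sqrt ((n + k - s).choose n * (n + s).choose n) := fun i hi =>
    Real.sqrt_le_sqrt (by exact_mod_cast choose_mul_choose_le_central hs hi)
  have lower : ∀ i ≤ k, (n + k - i).choose n * t i
      = Real.sqrt ((n + k - i).choose n * (n + i).choose n) := by
    intro i hi
    have := Real.sqrt_pos.2 (pos i hi).1
    rw [Real.sqrt_mul (pos i hi).1.le, ht]
    nth_rewrite 1 [← Real.mul_self_sqrt (pos i hi).1.le]
    field_simp
  have upper : ∀ i ≤ k, (n + i).choose n * (t i)⁻¹
      = Real.sqrt ((n + k - i).choose n * (n + i).choose n) := by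
    intro i hi
    have := Real.sqrt_pos.2 (pos i hi).2
    rw [Real.sqrt_mul (pos i hi).1.le, ht]
    nth_rewrite 1 [← Real.mul_self_sqrt (pos i hi).2.le]
    field_simp
  calc 2 * ∑ S ∈ Finset.powersetCard n Finset.univ, ∑ T ∈ Sᶜ.powerset,
        (starRingEnd ℂ (g T) * g (T ∪ S)).re
      ≤ ∑ S ∈ Finset.powersetCard n Finset.univ, ∑ T ∈ Sᶜ.powerset,
        (t T.card * ‖g T‖ ^ 2 + (t ((T ∪ S).card - n))⁻¹ * ‖g (T ∪ S)‖ ^ 2) := by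
        rw [Finset.mul_sum]
        refine Finset.sum_le_sum fun S hS => ?_
        rw [Finset.mul_sum]
        refine Finset.sum_le_sum fun T hT => ?_
        have hScard := (Finset.mem_powersetCard.1 hS).2
        rw [Finset.mem_powerset] at hT
        have hTcard : T.card ≤ k := by
          have := Finset.card_le_card hT
          rw [Finset.card_compl, Fintype.card_fin] at this
          omega
        rw [Finset.card_union_of_disjoint (Finset.subset_compl_iff_disjoint_right.1 hT), hScard,
          Nat.add_sub_cancel]
        exact two_mul_re_conj_mul_le _ _ (tpos _ hTcard)
    _ = ∑ T : Finset (Fin (n + k)), ((n + k - T.card).choose n * t T.card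
        + T.card.choose n * (t (T.card - n))⁻¹) * ‖g T‖ ^ 2 := by
        simp only [Finset.sum_add_distrib, add_mul]
        rw [sum_lower_vertex n fun T => t T.card * ‖g T‖ ^ 2,
          sum_upper_vertex n fun U => (t (U.card - n))⁻¹ * ‖g U‖ ^ 2]
        simp only [mul_assoc]
    _ ≤ _ := by
        rw [Finset.mul_sum]
        refine Finset.sum_le_sum fun T _ => mul_le_mul_of_nonneg_right ?_ (by positivity)
        have hT : T.card ≤ n + k := by simpa using T.card_le_univ
        generalize T.card = m at hT
        rcases le_or_gt m k with hm | hm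
        · rw [Nat.choose_eq_zero_of_lt (show m < n by omega), Nat.cast_zero, zero_mul, add_zero,
            lower m hm]
          exact deg m hm
        · rw [Nat.choose_eq_zero_of_lt (show n + k - m < n by omega), Nat.cast_zero, zero_mul,
            zero_add]
          rcases lt_or_ge m n with hmn | hmn
          · rw [Nat.choose_eq_zero_of_lt hmn, Nat.cast_zero, zero_mul]
            positivity
          · obtain ⟨i, rfl⟩ := Nat.exists_eq_add_of_le hmn
            rw [Nat.add_sub_cancel_left, upper i (by omega)]
            exact deg i (by omega)

lemma expect_symMABK_le {N k s : ℕ} (hk : 2 * k < N) (hs : s = k / 2 ∨ s = (k + 1) / 2)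
    (ψ : QubitVec N) :
    (symMABK N k).expect ψ ≤ N.choose k * piOptimum N k s * ‖ψ‖ ^ 2 := by
  have hval : (N.choose k : ℝ) * piOptimum N k s = 2 ^ (N - k - 1) *
      Real.sqrt ((N - s).choose (N - k) * (N - k + s).choose (N - k)) := by
    rw [← choose_mul_choose_eq_polygamous (show k ≤ N by omega) (show s ≤ k by omega), piOptimum]
    ring
  rw [hval, expect_symMABK (by omega), norm_sq_eq_sum_bitString]
  obtain ⟨n, rfl⟩ : ∃ n, N = n + k := ⟨N - k, by omega⟩
  have := sum_edges_le (show k < n by omega) hs fun T => ψ (bitString (n + k) T)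
  rw [Nat.add_sub_cancel, show 2 ^ n = (2 : ℝ) ^ (n - 1) * 2 by
    rw [← pow_succ, Nat.sub_add_cancel (by omega)], mul_assoc, mul_assoc]
  gcongr

/-! ### Permutation-invariant states -/

/-- On a permutation-invariant state every subsystem of a given size has the same expectation
value. -/
lemma expect_onSubsystem_of_card {N k : ℕ} (hk : k < N) (S : Finset (Fin N)) (hS : S.card = N - k)
    (ψ : QubitVec N) (f : ℕ → ℂ) (hf : ∀ T, ψ (bitString N T) = f T.card) :
    ((mabkGHZ (N - k)).onSubsystem S hS).expect ψ = 2 ^ (N - k) *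
      ∑ i ∈ Finset.range (k + 1), k.choose i * (starRingEnd ℂ (f i) * f (N - k + i)).re := by
  have hc : Sᶜ.card = k := by
    rw [Finset.card_compl, Fintype.card_fin, hS]
    omega
  rw [expect_mabkGHZ_onSubsystem (by omega)]
  congr 1
  rw [Finset.sum_congr rfl (g := fun T => (starRingEnd ℂ (f T.card) * f (N - k + T.card)).re),
    Finset.sum_powerset_apply_card (fun i => (starRingEnd ℂ (f i) * f (N - k + i)).re), hc]
  · simp only [nsmul_eq_mul]
  · intro T hT
    rw [Finset.mem_powerset, Finset.subset_compl_iff_disjoint_right] at hT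
    rw [hf, hf, Finset.card_union_of_disjoint hT, hS, add_comm (N - k)]

lemma expect_symMABK_of_card {N k : ℕ} (hk : k < N) (S : Finset (Fin N)) (hS : S.card = N - k)
    (ψ : QubitVec N) (f : ℕ → ℂ) (hf : ∀ T, ψ (bitString N T) = f T.card) :
    (symMABK N k).expect ψ
      = N.choose k * ((mabkGHZ (N - k)).onSubsystem S hS).expect ψ := by
  rw [symMABK, QubitOp.expect_sum, Finset.sum_congr rfl fun (R : {R : Finset (Fin N) // _}) _ =>
    (expect_onSubsystem_of_card hk R.1 R.2 ψ f hf).trans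
      (expect_onSubsystem_of_card hk S hS ψ f hf).symm]
  simp [Nat.choose_symm hk.le]

lemma dicke_bitString (N i : ℕ) (T : Finset (Fin N)) :
    dicke N i (bitString N T)
      = if T.card = i then ((1 / Real.sqrt (N.choose i) : ℝ) : ℂ) else 0 := by
  simp [dicke, bitString_eq_one_iff]

lemma piVec_bitString {N : ℕ} (c : Fin (N + 1) → ℂ) :
    ∃ f : ℕ → ℂ, ∀ T, piVec N c (bitString N T) = f T.card :=
  ⟨fun m => ∑ i : Fin (N + 1),
    c i * if m = i then ((1 / Real.sqrt (N.choose i) : ℝ) : ℂ) else 0,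
    fun T => by simp [piVec, dicke_bitString]⟩

lemma polygamousState_eq_piVec {N k s : ℕ} (hk : k ≤ N) (hs : s ≤ k) :
    ∃ c, polygamousState N k s = piVec N c := by
  refine ⟨Pi.single ⟨s, by omega⟩ ((1 / Real.sqrt 2 : ℝ) : ℂ)
    + Pi.single ⟨N - k + s, by omega⟩ ((1 / Real.sqrt 2 : ℝ) : ℂ), ?_⟩
  simp [piVec, polygamousState, add_smul, Finset.sum_add_distrib, Pi.single_apply, ite_smul]

/-- The coordinate of the polygamous state at a basis state with `m` excitations. -/
noncomputable def polygamousAmplitude (N k s m : ℕ) : ℝ :=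
  1 / Real.sqrt 2 * ((if m = s then 1 / Real.sqrt (N.choose s) else 0)
    + if m = N - k + s then 1 / Real.sqrt (N.choose (N - k + s)) else 0)

lemma polygamousState_bitString (N k s : ℕ) (T : Finset (Fin N)) :
    polygamousState N k s (bitString N T) = (polygamousAmplitude N k s T.card : ℂ) := by
  simp only [polygamousState, polygamousAmplitude, PiLp.smul_apply, PiLp.add_apply,
    dicke_bitString, smul_eq_mul, Complex.ofReal_mul, Complex.ofReal_add,
    apply_ite Complex.ofReal, Complex.ofReal_zero]

lemma norm_polygamousState {N k s : ℕ} (hk : k < N) (hs : s ≤ k) :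
    ‖polygamousState N k s‖ = 1 := by
  have p1 : (0 : ℝ) < N.choose s := by exact_mod_cast Nat.choose_pos (by omega)
  have p2 : (0 : ℝ) < N.choose (N - k + s) := by exact_mod_cast Nat.choose_pos (by omega)
  have hne : s ≠ N - k + s := by omega
  have amp (m : ℕ) : (N.choose m : ℝ) * polygamousAmplitude N k s m ^ 2
      = (if m = s then 1 / 2 else 0) + if m = N - k + s then 1 / 2 else 0 := by
    unfold polygamousAmplitude
    by_cases h1 : m = s
    · subst h1
      simp only [if_true, if_neg hne, add_zero, mul_pow, div_pow, one_pow,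
        Real.sq_sqrt p1.le, Real.sq_sqrt zero_le_two]
      field_simp
    · by_cases h2 : m = N - k + s
      · subst h2
        simp only [if_true, if_neg hne.symm, zero_add, mul_pow, div_pow, one_pow,
          Real.sq_sqrt p2.le, Real.sq_sqrt zero_le_two]
        field_simp
      · simp [h1, h2]
  have hsq : ‖polygamousState N k s‖ ^ 2 = 1 := by
    simp only [norm_sq_eq_sum_bitString, polygamousState_bitString, Complex.norm_real,
      Real.norm_eq_abs, sq_abs]
    rw [← Finset.powerset_univ, Finset.sum_powerset_apply_card fun m =>
      polygamousAmplitude N k s m ^ 2]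
    simp only [Finset.card_univ, Fintype.card_fin, nsmul_eq_mul, amp, Finset.sum_add_distrib,
      Finset.sum_ite_eq', Finset.mem_range]
    rw [if_pos (by omega), if_pos (by omega)]
    norm_num
  exact (pow_eq_one_iff_of_nonneg (norm_nonneg _) two_ne_zero).1 hsq

lemma expect_onSubsystem_polygamousState {N k s : ℕ} (hk : 2 * k < N) (hs : s ≤ k)
    (S : Finset (Fin N)) (hS : S.card = N - k) :
    ((mabkGHZ (N - k)).onSubsystem S hS).expect (polygamousState N k s) = piOptimum N k s := by
  rw [expect_onSubsystem_of_card (by omega) S hS _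
      (fun m => (polygamousAmplitude N k s m : ℂ)) (polygamousState_bitString N k s),
    Finset.sum_eq_single s]
  · have hsymm : N.choose (N - k + s) = N.choose (k - s) := by
      rw [← Nat.choose_symm (show k - s ≤ N by omega)]
      congr 1
      omega
    have h2 : (2 : ℝ) ^ (N - k) = 2 ^ (N - k - 1) * (Real.sqrt 2 * Real.sqrt 2) := by
      rw [Real.mul_self_sqrt zero_le_two, ← pow_succ, Nat.sub_add_cancel (by omega)]
    simp only [polygamousAmplitude, if_true, if_neg (show s ≠ N - k + s by omega),
      if_neg (show N - k + s ≠ s by omega),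
      add_zero, zero_add, Complex.conj_ofReal, ← Complex.ofReal_mul, Complex.ofReal_re, hsymm, h2,
      piOptimum]
    field_simp
  · intro i hi his
    have hi' := Finset.mem_range.1 hi
    simp [polygamousAmplitude, his, show i ≠ N - k + s by omega]
  · intro h
    exact absurd (Finset.mem_range.2 (by omega)) h

theorem proposition1 (N k s : ℕ) (hk : (k : ℝ) < (N : ℝ) / 2)
    -- `s` is `k / 2` rounded down or rounded up to an integer
    (hs : s = k / 2 ∨ s = (k + 1) / 2) :
    -- the MABK operator with GHZ settings in terms of Dicke states
    mabkGHZ (N - k) = (2 : ℂ) ^ (N - k - 1) •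
        (ketBra (dicke (N - k) 0) (dicke (N - k) (N - k))
          + ketBra (dicke (N - k) (N - k)) (dicke (N - k) 0)) ∧
    (symMABK N k).IsHermitian ∧
    -- the maximum over all `N`-qubit states, attained by the polygamous state
    IsGreatest {r : ℝ | ∃ ψ : QubitVec N, ‖ψ‖ = 1 ∧ (symMABK N k).expect ψ = r}
        ((N.choose k : ℝ) * piOptimum N k s) ∧
    ‖polygamousState N k s‖ = 1 ∧
    (symMABK N k).expect (polygamousState N k s) = (N.choose k : ℝ) * piOptimum N k s ∧
    -- `piOptimum` is the permutation-invariant optimum on each single subsystem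
    ∀ (S : Finset (Fin N)) (hS : S.card = N - k),
      IsGreatest {r : ℝ | ∃ c : Fin (N + 1) → ℂ, ‖piVec N c‖ = 1 ∧
          ((mabkGHZ (N - k)).onSubsystem S hS).expect (piVec N c) = r} (piOptimum N k s) ∧
      ((mabkGHZ (N - k)).onSubsystem S hS).expect (polygamousState N k s)
        = piOptimum N k s := by
  have hkN : 2 * k < N := by
    have : (2 * k : ℝ) < N := by linarith
    exact_mod_cast this
  have hsk : s ≤ k := by omega
  have hnorm := norm_polygamousState (show k < N by omega) hsk
  have hS := expect_onSubsystem_polygamousState hkN hsk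
  have hsym : (symMABK N k).expect (polygamousState N k s) = N.choose k * piOptimum N k s := by
    obtain ⟨S, -, hcard⟩ := Finset.exists_subset_card_eq
      (show N - k ≤ (Finset.univ : Finset (Fin N)).card by simp)
    rw [expect_symMABK_of_card (by omega) S hcard _
      (fun m => (polygamousAmplitude N k s m : ℂ)) (polygamousState_bitString N k s), hS]
  refine ⟨mabkGHZ_eq_ketBra (by omega), symMABK_isHermitian (by omega),
    ⟨⟨_, hnorm, hsym⟩, ?_⟩, hnorm, hsym, fun S hcard => ⟨⟨?_, ?_⟩, hS S hcard⟩⟩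
  · rintro r ⟨ψ, hψ, rfl⟩
    simpa [hψ] using expect_symMABK_le hkN hs ψ
  · obtain ⟨c, hc⟩ := polygamousState_eq_piVec (show k ≤ N by omega) hsk
    exact ⟨c, hc ▸ hnorm, hc ▸ hS S hcard⟩
  · rintro r ⟨c, hc, rfl⟩
    have h := expect_symMABK_le hkN hs (piVec N c)
    obtain ⟨f, hf⟩ := piVec_bitString c
    rw [expect_symMABK_of_card (by omega) S hcard _ f hf, hc, one_pow,
      mul_one] at h
    exact le_of_mul_le_mul_left h (by exact_mod_cast Nat.choose_pos (by omega))
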